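/- For $z=(x^m,y^m)$, where $x^m=(x_1,\dots,x_m)$ with $x_t\in\mathbb{R}^{d_x}$ and $y^m=(y_1,\dots,y_m)$ with $y_t\in\mathbb{R}^{d_y}$, write $(x^i,y^j)$ for the vector of dimension $d_x i+d_y j$ that consists of $x_1,\dots,x_i,y_1,\dots,y_j$. Let $(X^m,Y^m)$ be a jointly Gaussian pair of such sequences with mean zero, let $K_{i,j}$ be the covariance matrix of $(X^i,Y^j)$, and let $$I_{G,i,j}=\frac12\log\frac{|K_{i,j-1}|\,|K_{i-1,j}|}{|K_{i-1,j-1}|\,|K_{i,j}|},\qquad 1\le i,j\le m,$$ be the $(i,j)$ entry of its Gaussian InfoMat ($|K|$ is the determinant, and $|K_{0,0}|=1$). Given $N$ i.i.d. copies $(X^m,Y^m)_1,\dots,(X^m,Y^m)_N$, let $\hat K_{i,j}=\frac1N\sum_{l=1}^N v_l v_l^{\mathsf T}$ with $v_l=(X^i,Y^j)_l$ be the sample covariance matrix, and let $\hat I_{G,i,j}$ be the plug-in estimator obtained from the formula for $I_{G,i,j}$ by replacing every $K$ by $\hat K$. Let $d=\max(d_x,d_y)$. There is an absolute constant $C>0$,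 and for all $m,d_x,d_y$ there is $N_0=N_0(m,d_x,d_y)$, such that for every such Gaussian law and all $1\le i,j\le m$ for which $K_{i,j}$ is nonsingular: 1. (Bias) $\lim_{N\to\infty}\mathbb{E}\big[\hat I_{G,i,j}\big]=I_{G,i,j}$. 2. (Variance) For all $N\ge N_0$, the estimator $\hat I_{G,i,j}$ has a finite second moment and $$\mathsf{Var}\big(\hat I_{G,i,j}\big)\le C\,\frac{d\,m}{N};$$ in particular, if the $N$ sequences come from data of length $n\ge1$ with $N\ge n/m$, then $\mathsf{Var}(\hat I_{G,i,j})\le C\,\frac{d\,m^2}{n}$. -/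

import Mathlib

open MeasureTheory ProbabilityTheory

noncomputable section

namespace InfoMat

/-- A pair `(x^m, y^m)` of length `m` sequences, with `x_t ∈ ℝ^{dx}` and `y_t ∈ ℝ^{dy}`. -/
abbrev SeqPair (m dx dy : ℕ) : Type :=
  (Fin m → EuclideanSpace ℝ (Fin dx)) × (Fin m → EuclideanSpace ℝ (Fin dy))

/-- Indices of the scalar coordinates of the prefix `(x^i, y^j)`: the times of `x` are the first
`i` ones and the times of `y` are the first `j` ones. For `i, j ≤ m` there are `dx * i + dy * j`
of them. -/
abbrev PrefixIdx (m dx dy i j : ℕ) : Type :=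
  ({t : Fin m // (t : ℕ) < i} × Fin dx) ⊕ ({t : Fin m // (t : ℕ) < j} × Fin dy)

variable {m dx dy : ℕ}

/-- The prefix `(x^i, y^j)` of `z = (x^m, y^m)`, as one vector of scalar coordinates. -/
def prefixVec (z : SeqPair m dx dy) (i j : ℕ) : PrefixIdx m dx dy i j → ℝ
  | Sum.inl (t, a) => z.1 t.1 a
  | Sum.inr (t, b) => z.2 t.1 b

/-- The covariance matrix of the random prefix `(X^i, Y^j)`. -/
def covMatrix {Ω : Type*} [MeasurableSpace Ω] (P : Measure Ω) (Z : Ω → SeqPair m dx dy)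
    (i j : ℕ) : Matrix (PrefixIdx m dx dy i j) (PrefixIdx m dx dy i j) ℝ :=
  Matrix.of fun a b =>
    covariance (fun ω => prefixVec (Z ω) i j a) (fun ω => prefixVec (Z ω) i j b) P

/-- The sample covariance matrix `N⁻¹ ∑ₗ vₗ vₗᵀ` of the prefixes `vₗ = (x^i, y^j)ₗ` of `N`
sequences (for data known to have mean zero). -/
def sampleCovMatrix {N : ℕ} (z : Fin N → SeqPair m dx dy) (i j : ℕ) :
    Matrix (PrefixIdx m dx dy i j) (PrefixIdx m dx dy i j) ℝ :=
  (N : ℝ)⁻¹ • ∑ l : Fin N, Matrix.vecMulVec (prefixVec (z l) i j) (prefixVec (z l) i j)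

/-- The `m × m` matrix of the log-determinant formula, for a family `K i j` of matrices in the
roles of the covariance matrices of `(X^i, Y^j)`. Rows and columns are counted from `0`, so the
entry in row `i` and column `j` is the one of the times `i + 1` and `j + 1`, whose pasts have
lengths `i` and `j`. -/
def logDetMatrix (K : ∀ i j : ℕ, Matrix (PrefixIdx m dx dy i j) (PrefixIdx m dx dy i j) ℝ) :
    Matrix (Fin m) (Fin m) ℝ :=
  Matrix.of fun i j =>
    (1 / 2 : ℝ) * Real.log
      (((K (i + 1) j).det * (K i (j + 1)).det) / ((K i j).det * (K (i + 1) (j + 1)).det))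

/-- The Gaussian InfoMat of a random pair of sequences. -/
def gaussianInfoMat {Ω : Type*} [MeasurableSpace Ω] (P : Measure Ω) (Z : Ω → SeqPair m dx dy) :
    Matrix (Fin m) (Fin m) ℝ :=
  logDetMatrix fun i j => covMatrix P Z i j

/-- The plug-in estimator of the Gaussian InfoMat from `N` sequences. -/
def gaussianInfoMatEstimator {N : ℕ} (z : Fin N → SeqPair m dx dy) : Matrix (Fin m) (Fin m) ℝ :=
  logDetMatrix fun i j => sampleCovMatrix z i j

end InfoMat

end

namespace InfoMat

/-! ### Gaussian and Gamma integrals -/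

section GaussianIntegrals

variable {ι : Type*} [Fintype ι]

/-! The entry is half a signed sum of four log-determinants, so it suffices to control the
log-determinant of one sample covariance matrix of size `D`, uniformly in the law. Let `S` be the
scatter matrix of `N` centered Gaussian vectors with covariance `K`, and let `w = det S /
(N(N-1)⋯(N-D+1) det K)`. The aim is `E[log² w] ≤ 8D/N`.

The elementary bound `log² w ≤ 2w + 4w^(-1/2) - 6` (`sq_log_le_add_inv_sqrt`) reduces this to two
moments. The first is exact: expanding the determinant over samples gives `E[w] = 1`
(`integrable_det_scatter`). For the second, `(det S)^(-1/2)` is bounded by a Gaussian integral of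
`exp(-xᵀSx/2)`; exchanging integrals bounds its mean by a ratio of Gamma functions
(`lintegral_det_scatter_rpow_neg_half_le`). Log-convexity of Gamma then gives `E[w^(-1/2)]² ≤ 1 +
4D/N`, and the two moments leave only `O(D/N)`. Finiteness of the negative moment also shows that
`det S > 0` almost surely.

Since `D ≤ 2dm`, each log-determinant equals its true value, plus a deterministic shift tending to
zero with `N`, plus an error with second moment `O(dm/N)`. Summing four of these yields the variance
bound, and the same second moment bounds the bias. -/

theorem lintegral_comp_quadraticForm [DecidableEq ι] {K : Matrix ι ι ℝ} (hK : K.PosDef)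
    {f : ℝ → ENNReal} (hf : Measurable f) :
    ∫⁻ x : ι → ℝ, f (x ⬝ᵥ K.mulVec x) =
      ENNReal.ofReal (√K.det)⁻¹ * ∫⁻ x : ι → ℝ, f (x ⬝ᵥ x) := by
  -- With `K = BᵀB`, the substitution `y = Bx` has Jacobian `|det B| = √(det K)`.
  obtain ⟨B, hB⟩ : ∃ B : Matrix ι ι ℝ, K = star B * B := by
    open scoped MatrixOrder Matrix.Norms.L2Operator in
    exact CStarAlgebra.nonneg_iff_eq_star_mul_self.mp
      (Matrix.nonneg_iff_posSemidef.mpr hK.posSemidef)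
  rw [Matrix.star_eq_conjTranspose, Matrix.conjTranspose_eq_transpose_of_trivial] at hB
  have hdet : K.det = B.det ^ 2 := by rw [hB, Matrix.det_mul, Matrix.det_transpose, sq]
  have hB0 : B.det ≠ 0 := by
    intro h
    have := hK.det_pos
    rw [hdet, h] at this
    simp at this
  have hq : ∀ x : ι → ℝ, x ⬝ᵥ K.mulVec x = (Matrix.toLin' B x) ⬝ᵥ (Matrix.toLin' B x) := by
    intro x
    rw [hB, Matrix.toLin'_apply, ← Matrix.mulVec_mulVec, Matrix.dotProduct_mulVec,
      Matrix.vecMul_transpose]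
  have hg : Measurable fun x : ι → ℝ => f (x ⬝ᵥ x) := by
    refine hf.comp ?_
    simp only [dotProduct]
    fun_prop
  have hBm : Measurable (Matrix.toLin' B) :=
    (LinearMap.continuous_of_finiteDimensional (Matrix.toLin' B)).measurable
  calc ∫⁻ x : ι → ℝ, f (x ⬝ᵥ K.mulVec x)
      = ∫⁻ x : ι → ℝ, f ((Matrix.toLin' B x) ⬝ᵥ (Matrix.toLin' B x)) := by simp only [hq]
    _ = ∫⁻ y, f (y ⬝ᵥ y) ∂(Measure.map (Matrix.toLin' B) volume) := by
        rw [lintegral_map hg hBm]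
    _ = _ := by
        rw [Real.map_matrix_volume_pi_eq_smul_volume_pi hB0, lintegral_smul_measure, hdet,
          Real.sqrt_sq_eq_abs, abs_inv, smul_eq_mul]

theorem lintegral_exp_neg_mul_dotProduct_self {t : ℝ} (ht : 0 < t) :
    ∫⁻ x : ι → ℝ, ENNReal.ofReal (Real.exp (-t * (x ⬝ᵥ x))) =
      ENNReal.ofReal (√(Real.pi / t) ^ Fintype.card ι) := by
  have hprod : ∀ x : ι → ℝ, Real.exp (-t * (x ⬝ᵥ x)) = ∏ i, Real.exp (-t * x i ^ 2) := by
    intro x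
    rw [← Real.exp_sum, dotProduct, Finset.mul_sum]
    simp only [sq]
  rw [← ofReal_integral_eq_lintegral_ofReal]
  · simp only [hprod]
    rw [integral_fintype_prod_volume_eq_pow (fun x : ℝ => Real.exp (-t * x ^ 2)),
      integral_gaussian]
  · simp only [hprod]
    exact Integrable.fintype_prod (f := fun _ (x : ℝ) => Real.exp (-t * x ^ 2))
      fun _ => integrable_exp_neg_mul_sq ht
  · exact Filter.Eventually.of_forall fun x => (Real.exp_pos _).le

theorem lintegral_rpow_mul_exp_neg_mul {a r : ℝ} (ha : 0 < a) (hr : 0 < r) :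
    ∫⁻ t in Set.Ioi (0 : ℝ), ENNReal.ofReal (t ^ (a - 1) * Real.exp (-(r * t))) =
      ENNReal.ofReal ((1 / r) ^ a * Real.Gamma a) := by
  rw [← Real.integral_rpow_mul_exp_neg_mul_Ioi ha hr, ofReal_integral_eq_lintegral_ofReal]
  -- Integrability comes for free: a non-integrable function would have Bochner integral `0`, but
  -- the Gamma value is positive.
  · by_contra h
    have h0 := Real.integral_rpow_mul_exp_neg_mul_Ioi ha hr
    rw [integral_undef h] at h0
    have : 0 < (1 / r) ^ a * Real.Gamma a :=
      mul_pos (Real.rpow_pos_of_pos (by positivity) _) (Real.Gamma_pos_of_pos ha)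
    linarith
  · filter_upwards [self_mem_ae_restrict measurableSet_Ioi] with t ht
    exact mul_nonneg (Real.rpow_nonneg (le_of_lt ht) _) (Real.exp_pos _).le

/-- Write the power as a Gamma integral in `t` and exchange by Tonelli. The Gaussian integral in `x`
contributes `(π/t)^(D/2)`, which lowers the Gamma exponent from `p` to `p - D/2`. -/
theorem lintegral_one_add_dotProduct_self_rpow {p : ℝ} (hp : (Fintype.card ι : ℝ) / 2 < p) :
    ∫⁻ x : ι → ℝ, ENNReal.ofReal ((1 + x ⬝ᵥ x) ^ (-p)) =
      ENNReal.ofReal (√Real.pi ^ Fintype.card ι *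
        Real.Gamma (p - (Fintype.card ι : ℝ) / 2) / Real.Gamma p) := by
  set D := Fintype.card ι with hD
  have hp0 : 0 < p := lt_of_le_of_lt (by positivity) hp
  have hΓ := Real.Gamma_pos_of_pos hp0
  have hs : ∀ x : ι → ℝ, 0 < 1 + x ⬝ᵥ x := fun x => by
    have : 0 ≤ x ⬝ᵥ x := Finset.sum_nonneg fun i _ => mul_self_nonneg _
    linarith
  have h1 : ∀ x : ι → ℝ, ENNReal.ofReal ((1 + x ⬝ᵥ x) ^ (-p)) =
      ENNReal.ofReal (Real.Gamma p)⁻¹ * ∫⁻ t in Set.Ioi (0 : ℝ),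
        ENNReal.ofReal (t ^ (p - 1) * Real.exp (-((1 + x ⬝ᵥ x) * t))) := by
    intro x
    rw [lintegral_rpow_mul_exp_neg_mul hp0 (hs x), ← ENNReal.ofReal_mul (by positivity),
      one_div, Real.inv_rpow (hs x).le, Real.rpow_neg (hs x).le]
    congr 1
    field_simp
  simp only [h1]
  have hmeas : Measurable (Function.uncurry fun (x : ι → ℝ) (t : ℝ) =>
      ENNReal.ofReal (t ^ (p - 1) * Real.exp (-((1 + x ⬝ᵥ x) * t)))) := by
    simp only [dotProduct, Function.uncurry_def]
    fun_prop
  rw [lintegral_const_mul' _ _ ENNReal.ofReal_ne_top,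
    lintegral_lintegral_swap hmeas.aemeasurable]
  have h2 : ∀ t ∈ Set.Ioi (0 : ℝ), ∫⁻ x : ι → ℝ,
      ENNReal.ofReal (t ^ (p - 1) * Real.exp (-((1 + x ⬝ᵥ x) * t))) =
      ENNReal.ofReal (√Real.pi ^ D) *
        ENNReal.ofReal (t ^ (p - (D : ℝ) / 2 - 1) * Real.exp (-(1 * t))) := by
    intro t ht
    have ht : 0 < t := ht
    have : ∀ x : ι → ℝ, ENNReal.ofReal (t ^ (p - 1) * Real.exp (-((1 + x ⬝ᵥ x) * t))) =
        ENNReal.ofReal (t ^ (p - 1) * Real.exp (-(1 * t))) *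
          ENNReal.ofReal (Real.exp (-t * (x ⬝ᵥ x))) := by
      intro x
      rw [← ENNReal.ofReal_mul (by positivity), mul_assoc, ← Real.exp_add]
      congr 3
      ring
    simp only [this]
    rw [lintegral_const_mul' _ _ ENNReal.ofReal_ne_top,
      lintegral_exp_neg_mul_dotProduct_self ht, ← ENNReal.ofReal_mul (by positivity),
      ← ENNReal.ofReal_mul (by positivity), ← hD]
    congr 1
    rw [Real.sqrt_div Real.pi_pos.le, div_pow]
    have h3 : t ^ (p - (D : ℝ) / 2 - 1) = t ^ (p - 1) / √t ^ D := by
      rw [show p - (D : ℝ) / 2 - 1 = (p - 1) - (1 / 2) * (D : ℝ) by ring,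
        Real.rpow_sub ht, Real.rpow_mul ht.le, Real.sqrt_eq_rpow, Real.rpow_natCast]
    rw [h3]
    ring
  rw [setLIntegral_congr_fun measurableSet_Ioi h2,
    lintegral_const_mul' _ _ ENNReal.ofReal_ne_top,
    lintegral_rpow_mul_exp_neg_mul (by linarith) one_pos, ← ENNReal.ofReal_mul (by positivity),
    ← ENNReal.ofReal_mul (by positivity)]
  congr 1
  rw [div_one, Real.one_rpow]
  ring

/-- Equality holds for `M + εI`, whose integral is at most that of `M`; let `ε → 0`. Singular `M` is
allowed on purpose: there the left side is `∞`, so a finite mean of it forces nonsingularity almost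
surely. -/
theorem rpow_det_le_lintegral_exp_neg_quadraticForm [DecidableEq ι] {M : Matrix ι ι ℝ}
    (hM : M.PosSemidef) :
    ENNReal.ofReal (√(2 * Real.pi) ^ Fintype.card ι) *
        ENNReal.ofReal M.det ^ (-(1 / 2) : ℝ) ≤
      ∫⁻ x : ι → ℝ, ENNReal.ofReal (Real.exp (-(1 / 2) * (x ⬝ᵥ M.mulVec x))) := by
  set c := ENNReal.ofReal (√(2 * Real.pi) ^ Fintype.card ι) with hc
  have hcont : Continuous fun ε : ℝ =>
      c * ENNReal.ofReal (M + ε • (1 : Matrix ι ι ℝ)).det ^ (-(1 / 2) : ℝ) := by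
    refine ENNReal.continuous_const_mul ENNReal.ofReal_ne_top |>.comp ?_
    refine ENNReal.continuous_rpow_const.comp (ENNReal.continuous_ofReal.comp ?_)
    fun_prop
  have hlim := (hcont.tendsto 0).mono_left (nhdsWithin_le_nhds (s := Set.Ioi 0))
  simp only [zero_smul, add_zero] at hlim
  refine le_of_tendsto hlim ?_
  filter_upwards [self_mem_nhdsWithin] with ε hε
  have hε : 0 < ε := hε
  have hpd : (M + ε • (1 : Matrix ι ι ℝ)).PosDef := by
    rw [add_comm]
    exact (Matrix.PosDef.one.smul hε).add_posSemidef hM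
  have hdet := hpd.det_pos
  have key := lintegral_comp_quadraticForm hpd
    (f := fun s => ENNReal.ofReal (Real.exp (-(1 / 2) * s))) (by fun_prop)
  rw [lintegral_exp_neg_mul_dotProduct_self (by norm_num)] at key
  have h1 : ENNReal.ofReal (M + ε • (1 : Matrix ι ι ℝ)).det ^ (-(1 / 2) : ℝ) =
      ENNReal.ofReal (√(M + ε • (1 : Matrix ι ι ℝ)).det)⁻¹ := by
    rw [ENNReal.ofReal_rpow_of_pos hdet, Real.rpow_neg hdet.le, Real.sqrt_eq_rpow]
  rw [h1, mul_comm, hc, show (2 * Real.pi : ℝ) = Real.pi / (1 / 2) by ring, ← key]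
  refine lintegral_mono fun x => ENNReal.ofReal_le_ofReal (Real.exp_le_exp.mpr ?_)
  have : 0 ≤ ε * (x ⬝ᵥ x) :=
    mul_nonneg hε.le (Finset.sum_nonneg fun i _ => mul_self_nonneg _)
  rw [Matrix.add_mulVec, dotProduct_add, Matrix.smul_mulVec, Matrix.one_mulVec, dotProduct_smul,
    smul_eq_mul]
  linarith

theorem lintegral_exp_neg_sq_gaussianReal (v : NNReal) :
    ∫⁻ s, ENNReal.ofReal (Real.exp (-(1 / 2) * s ^ 2)) ∂(gaussianReal 0 v) =
      ENNReal.ofReal (√(1 + v))⁻¹ := by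
  -- The variance may be `0`, where no density exists, so the integral is pulled back to the
  -- standard Gaussian.
  have hmap : gaussianReal 0 v = Measure.map (fun x => √v * x) (gaussianReal 0 1) := by
    rw [gaussianReal_map_const_mul]
    congr 1
    · simp
    · ext
      simp
  have h1v : (0 : ℝ) < 1 + v := by positivity
  rw [hmap, lintegral_map (by fun_prop) (by fun_prop), gaussianReal_of_var_ne_zero _ one_ne_zero,
    lintegral_withDensity_eq_lintegral_mul _ (by fun_prop) (by fun_prop)]
  have : ∀ x : ℝ, (gaussianPDF 0 1 * fun x => ENNReal.ofReal
      (Real.exp (-(1 / 2) * (√(v : ℝ) * x) ^ 2))) x =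
      ENNReal.ofReal ((√(2 * Real.pi))⁻¹ * Real.exp (-((1 + v) / 2) * x ^ 2)) := by
    intro x
    simp only [Pi.mul_apply, gaussianPDF, gaussianPDFReal]
    rw [← ENNReal.ofReal_mul (by positivity), mul_assoc, ← Real.exp_add, mul_pow,
      Real.sq_sqrt v.coe_nonneg]
    congr 3
    · simp
    · simp
      ring
  simp only [this]
  rw [← ofReal_integral_eq_lintegral_ofReal, integral_const_mul, integral_gaussian]
  · congr 1
    rw [div_div_eq_mul_div, Real.sqrt_div (by positivity), mul_comm Real.pi]
    field_simp
  · exact (integrable_exp_neg_mul_sq (by positivity)).const_mul _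
  · exact Filter.Eventually.of_forall fun x => by positivity

end GaussianIntegrals

/-! ### Moments of order -1/2 and 1 of the determinant of a scatter matrix -/

section ScatterMoments

variable {ι : Type*} [Fintype ι] {N : ℕ}

/-- The scatter matrix `∑ₗ vₗ vₗᵀ` of finitely many vectors. -/
def scatter (z : Fin N → ι → ℝ) : Matrix ι ι ℝ :=
  ∑ l : Fin N, Matrix.vecMulVec (z l) (z l)

theorem dotProduct_scatter_mulVec (z : Fin N → ι → ℝ) (x : ι → ℝ) :
    x ⬝ᵥ (scatter z).mulVec x = ∑ l, (x ⬝ᵥ z l) ^ 2 := by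
  rw [scatter, Matrix.sum_mulVec, dotProduct_sum]
  refine Finset.sum_congr rfl fun l _ => ?_
  rw [Matrix.vecMulVec_mulVec, op_smul_eq_smul, dotProduct_smul, smul_eq_mul,
    dotProduct_comm (z l) x, sq]

theorem posSemidef_scatter (z : Fin N → ι → ℝ) : (scatter z).PosSemidef := by
  refine Matrix.PosSemidef.of_dotProduct_mulVec_nonneg ?_ fun x => ?_
  · rw [Matrix.IsHermitian, Matrix.conjTranspose_eq_transpose_of_trivial, scatter,
      Matrix.transpose_sum]
    simp only [Matrix.transpose_vecMulVec]
  · rw [star_trivial, dotProduct_scatter_mulVec]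
    positivity

theorem measurable_det_scatter [DecidableEq ι] :
    Measurable fun z : Fin N → ι → ℝ => (scatter z).det := by
  refine Continuous.measurable (Continuous.matrix_det ?_)
  unfold scatter
  refine continuous_finsetSum _ fun l _ => Continuous.matrix_vecMulVec ?_ ?_ <;> fun_prop

variable {μ : Measure (ι → ℝ)} [IsProbabilityMeasure μ] {K : Matrix ι ι ℝ}

/-- Replace the power of the determinant by a Gaussian integral over `x` and exchange. For fixed
`x`, `exp(-xᵀSx/2)` is a product over independent samples, each with mean `(1 + xᵀKx)^(-1/2)`; the
remaining integral of `(1 + xᵀKx)^(-N/2)` converges because `D < N`. -/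
theorem lintegral_det_scatter_rpow_neg_half_le [DecidableEq ι] (hK : K.PosDef)
    (hμ : ∀ x : ι → ℝ, μ.map (fun v => x ⬝ᵥ v) = gaussianReal 0 (x ⬝ᵥ K.mulVec x).toNNReal)
    (hN : Fintype.card ι < N) :
    ∫⁻ z, ENNReal.ofReal (scatter z).det ^ (-(1 / 2) : ℝ) ∂(Measure.pi fun _ : Fin N => μ) ≤
      ENNReal.ofReal ((√K.det)⁻¹ * (√2 ^ Fintype.card ι)⁻¹ *
        (Real.Gamma (((N : ℝ) - Fintype.card ι) / 2) / Real.Gamma ((N : ℝ) / 2))) := by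
  set D := Fintype.card ι with hD
  set c := ENNReal.ofReal (√(2 * Real.pi) ^ D) with hc
  have hcpos : 0 < √(2 * Real.pi) ^ D := by positivity
  have hc0 : c ≠ 0 := (ENNReal.ofReal_pos.mpr hcpos).ne'
  have hq0 : ∀ x : ι → ℝ, 0 ≤ x ⬝ᵥ K.mulVec x := fun x => by
    simpa using hK.posSemidef.dotProduct_mulVec_nonneg x
  have hdot : ∀ x : ι → ℝ, Measurable fun v : ι → ℝ => x ⬝ᵥ v := fun x => by
    simp only [dotProduct]
    fun_prop
  have hone : ∀ x : ι → ℝ, ∫⁻ v, ENNReal.ofReal (Real.exp (-(1 / 2) * (x ⬝ᵥ v) ^ 2)) ∂μ =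
      ENNReal.ofReal (√(1 + x ⬝ᵥ K.mulVec x))⁻¹ := by
    intro x
    have h := lintegral_exp_neg_sq_gaussianReal (x ⬝ᵥ K.mulVec x).toNNReal
    rw [← hμ x, lintegral_map (by fun_prop) (hdot x), Real.coe_toNNReal _ (hq0 x)] at h
    exact h
  have hmeas : Measurable (Function.uncurry fun (z : Fin N → ι → ℝ) (x : ι → ℝ) =>
      ENNReal.ofReal (Real.exp (-(1 / 2) * (x ⬝ᵥ (scatter z).mulVec x)))) := by
    simp only [dotProduct_scatter_mulVec, Function.uncurry_def]
    simp only [dotProduct]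
    fun_prop
  have hinner : ∀ x : ι → ℝ, ∫⁻ z, ENNReal.ofReal (Real.exp (-(1 / 2) *
      (x ⬝ᵥ (scatter z).mulVec x))) ∂(Measure.pi fun _ : Fin N => μ) =
      ENNReal.ofReal ((1 + x ⬝ᵥ K.mulVec x) ^ (-((N : ℝ) / 2))) := by
    intro x
    have hpos : 0 < 1 + x ⬝ᵥ K.mulVec x := by linarith [hq0 x]
    have hg : Measurable fun v : ι → ℝ => ENNReal.ofReal (Real.exp (-(1 / 2) * (x ⬝ᵥ v) ^ 2)) := by
      have := hdot x
      fun_prop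
    have hfac : ∀ z : Fin N → ι → ℝ, ENNReal.ofReal (Real.exp (-(1 / 2) *
        (x ⬝ᵥ (scatter z).mulVec x))) =
        ∏ l, ENNReal.ofReal (Real.exp (-(1 / 2) * (x ⬝ᵥ z l) ^ 2)) := by
      intro z
      rw [dotProduct_scatter_mulVec, Finset.mul_sum, Real.exp_sum,
        ENNReal.ofReal_prod_of_nonneg fun _ _ => (Real.exp_pos _).le]
    simp only [hfac]
    rw [lintegral_prod_eq_prod_lintegral_of_indepFun Finset.univ
      (fun l (z : Fin N → ι → ℝ) => ENNReal.ofReal (Real.exp (-(1 / 2) * (x ⬝ᵥ z l) ^ 2)))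
      (iIndepFun_pi (μ := fun _ : Fin N => μ) fun _ => hg.aemeasurable)
      fun l => hg.comp (measurable_pi_apply l)]
    have : ∀ l : Fin N, ∫⁻ z, ENNReal.ofReal (Real.exp (-(1 / 2) * (x ⬝ᵥ z l) ^ 2))
        ∂(Measure.pi fun _ : Fin N => μ) = ENNReal.ofReal (√(1 + x ⬝ᵥ K.mulVec x))⁻¹ := by
      intro l
      rw [← hone x]
      exact (measurePreserving_eval (fun _ : Fin N => μ) l).lintegral_comp hg
    rw [Finset.prod_congr rfl fun l _ => this l, Finset.prod_const, Finset.card_univ,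
      Fintype.card_fin, ← ENNReal.ofReal_pow (by positivity), Real.rpow_neg hpos.le, inv_pow,
      Real.sqrt_eq_rpow, ← Real.rpow_natCast, ← Real.rpow_mul hpos.le]
    congr 3
    ring
  have hND : (D : ℝ) / 2 < (N : ℝ) / 2 := by
    have : (D : ℝ) < N := by exact_mod_cast hN
    linarith
  have hmain : c * ∫⁻ z, ENNReal.ofReal (scatter z).det ^ (-(1 / 2) : ℝ)
        ∂(Measure.pi fun _ : Fin N => μ) ≤
      c * ENNReal.ofReal ((√K.det)⁻¹ * (√2 ^ D)⁻¹ *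
        (Real.Gamma (((N : ℝ) - D) / 2) / Real.Gamma ((N : ℝ) / 2))) := by
    calc _ = ∫⁻ z, c * ENNReal.ofReal (scatter z).det ^ (-(1 / 2) : ℝ)
              ∂(Measure.pi fun _ : Fin N => μ) := by
          rw [lintegral_const_mul' _ _ ENNReal.ofReal_ne_top]
      _ ≤ ∫⁻ z, ∫⁻ x : ι → ℝ, ENNReal.ofReal (Real.exp (-(1 / 2) *
            (x ⬝ᵥ (scatter z).mulVec x))) ∂volume ∂(Measure.pi fun _ : Fin N => μ) :=
          lintegral_mono fun z => rpow_det_le_lintegral_exp_neg_quadraticForm (posSemidef_scatter z)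
      _ = ∫⁻ x : ι → ℝ, ENNReal.ofReal ((1 + x ⬝ᵥ K.mulVec x) ^ (-((N : ℝ) / 2))) := by
          rw [lintegral_lintegral_swap hmeas.aemeasurable]
          simp only [hinner]
      _ = _ := by
          rw [lintegral_comp_quadraticForm hK
            (f := fun s => ENNReal.ofReal ((1 + s) ^ (-((N : ℝ) / 2)))) (by fun_prop),
            lintegral_one_add_dotProduct_self_rpow hND, ← ENNReal.ofReal_mul (by positivity),
            hc, ← ENNReal.ofReal_mul (by positivity), ← hD, Real.sqrt_mul zero_le_two, mul_pow,
            sub_div]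
          congr 1
          field_simp
  exact (ENNReal.mul_le_mul_iff_right hc0 ENNReal.ofReal_ne_top).mp hmain

/-- Each row of the scatter matrix is a sum over samples, so multilinearity expands the determinant
over choices `r` of one sample per row. Only injective choices survive, and for these the factors
are independent. -/
theorem det_scatter_eq_sum [DecidableEq ι] (z : Fin N → ι → ℝ) :
    (scatter z).det = ∑ r : ι → Fin N with Function.Injective r,
      ∑ σ : Equiv.Perm ι, ((σ.sign : ℤ) : ℝ) * ∏ a, (z (r a) a * z (r a) (σ a)) := by
  have h1 : scatter z = fun a => ∑ l : Fin N, fun b => z l a * z l b := by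
    ext a b
    simp [scatter, Matrix.sum_apply, Matrix.vecMulVec_apply]
  have h2 : (scatter z).det = ∑ r : ι → Fin N,
      (Matrix.of fun a b => z (r a) a * z (r a) b).det := by
    rw [h1]
    exact (Matrix.detRowAlternating (R := ℝ) (n := ι)).toMultilinearMap.map_sum
      (fun a (l : Fin N) => fun b => z l a * z l b)
  rw [h2, Finset.sum_filter]
  refine Finset.sum_congr rfl fun r _ => ?_
  split_ifs with hr
  · rw [← Matrix.det_transpose, Matrix.det_apply']
    rfl
  -- When `r a = r b`, rows `a` and `b` are multiples of the same sample vector.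
  · rw [Function.Injective] at hr
    push Not at hr
    obtain ⟨a, b, hab, hne⟩ := hr
    have h3 := Matrix.det_mul_column (fun a => z (r a) a) (Matrix.of fun a => z (r a))
    rw [Matrix.det_zero_of_row_eq (M := Matrix.of fun a => z (r a)) hne
      (congrArg z hab), mul_zero] at h3
    exact h3

theorem integrable_prod_comp_injective {r : ι → Fin N} (hr : Function.Injective r)
    {f : ι → (ι → ℝ) → ℝ} (hf : ∀ a, Integrable (f a) μ) :
    Integrable (fun z : Fin N → ι → ℝ => ∏ a, f a (z (r a))) (Measure.pi fun _ : Fin N => μ) ∧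
      ∫ z, ∏ a, f a (z (r a)) ∂(Measure.pi fun _ : Fin N => μ) = ∏ a, ∫ v, f a v ∂μ := by
  have hind : iIndepFun (fun a (z : Fin N → ι → ℝ) => z (r a)) (Measure.pi fun _ : Fin N => μ) :=
    (iIndepFun_pi (μ := fun _ : Fin N => μ) (X := fun _ v => v)
      fun _ => aemeasurable_id).precomp hr
  have hmap : (Measure.pi fun _ : Fin N => μ).map (fun z a => z (r a)) =
      Measure.pi fun _ : ι => μ := by
    rw [hind.map_fun_eq_pi_map fun a => (measurable_pi_apply _).aemeasurable]
    congr 1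
    ext1 a
    exact (measurePreserving_eval (fun _ : Fin N => μ) (r a)).map_eq
  have hmp : MeasurePreserving (fun (z : Fin N → ι → ℝ) a => z (r a))
      (Measure.pi fun _ : Fin N => μ) (Measure.pi fun _ : ι => μ) := ⟨by fun_prop, hmap⟩
  have hint := Integrable.fintype_prod (μ := fun _ : ι => μ) hf
  refine ⟨hmp.integrable_comp_of_integrable hint, ?_⟩
  rw [← integral_fintype_prod_eq_prod (μ := fun _ : ι => μ), ← hmap, integral_map]
  · exact hmp.measurable.aemeasurable
  · rw [hmap]
    exact hint.aestronglyMeasurable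

theorem integrable_det_scatter [DecidableEq ι]
    (hint : ∀ a b, Integrable (fun v => v a * v b) μ)
    (hcov : ∀ a b, ∫ v, v a * v b ∂μ = K a b) :
    Integrable (fun z => (scatter z).det) (Measure.pi fun _ : Fin N => μ) ∧
      ∫ z, (scatter z).det ∂(Measure.pi fun _ : Fin N => μ) =
        (N.descFactorial (Fintype.card ι) : ℝ) * K.det := by
  simp only [det_scatter_eq_sum]
  have hterm : ∀ r ∈ (Finset.univ.filter fun r : ι → Fin N => Function.Injective r),
      ∀ σ ∈ (Finset.univ : Finset (Equiv.Perm ι)),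
      Integrable (fun z : Fin N → ι → ℝ =>
        ((σ.sign : ℤ) : ℝ) * ∏ a, (z (r a) a * z (r a) (σ a))) (Measure.pi fun _ : Fin N => μ) :=
    fun r hr σ _ => (integrable_prod_comp_injective (Finset.mem_filter.mp hr).2
      (f := fun a v => v a * v (σ a)) fun a => hint a (σ a)).1.const_mul _
  refine ⟨integrable_finsetSum _ fun r hr => integrable_finsetSum _ (hterm r hr), ?_⟩
  rw [integral_finsetSum _ fun r hr => integrable_finsetSum _ (hterm r hr)]
  have hval : ∀ r ∈ (Finset.univ.filter fun r : ι → Fin N => Function.Injective r),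
      ∫ z : Fin N → ι → ℝ, ∑ σ : Equiv.Perm ι, ((σ.sign : ℤ) : ℝ) *
        ∏ a, (z (r a) a * z (r a) (σ a)) ∂(Measure.pi fun _ : Fin N => μ) = K.det := by
    intro r hr
    rw [integral_finsetSum _ (hterm r hr), ← Matrix.det_transpose, Matrix.det_apply']
    refine Finset.sum_congr rfl fun σ _ => ?_
    rw [integral_const_mul, (integrable_prod_comp_injective (Finset.mem_filter.mp hr).2
      (f := fun a v => v a * v (σ a)) fun a => hint a (σ a)).2]
    simp only [hcov, Matrix.transpose_apply]
  rw [Finset.sum_congr rfl hval, Finset.sum_const, nsmul_eq_mul]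
  -- Each injective choice contributes `det K`, and the number of injections is the falling
  -- factorial.
  congr 2
  rw [← Fintype.card_subtype, Fintype.card_congr (Equiv.subtypeInjectiveEquivEmbedding ι (Fin N)),
    Fintype.card_embedding_eq, Fintype.card_fin]

end ScatterMoments

/-! ### Second moment of the centered log-determinant -/

section LogDetSecondMoment

/-- For `s = log u / 2` this is `s² ≤ sinh² s`, since `4 sinh² s = u + u⁻¹ - 2`. -/
theorem sq_log_le_add_inv {u : ℝ} (hu : 0 < u) : Real.log u ^ 2 ≤ u + u⁻¹ - 2 := by
  set s := Real.log u / 2 with hs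
  have h1 : s ^ 2 ≤ Real.sinh s ^ 2 := by
    rcases le_total 0 s with h | h
    · exact pow_le_pow_left₀ h (Real.self_le_sinh_iff.mpr h) 2
    · have := Real.sinh_le_self_iff.mpr h
      nlinarith
  have h2 : Real.sinh s ^ 2 = (u + u⁻¹ - 2) / 4 := by
    have e1 : Real.exp s ^ 2 = u := by
      rw [← Real.exp_nat_mul, hs]
      push_cast
      rw [mul_div_cancel₀ _ (two_ne_zero), Real.exp_log hu]
    have e2 : Real.exp (-s) ^ 2 = u⁻¹ := by rw [Real.exp_neg, inv_pow, e1]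
    have e3 : Real.exp s * Real.exp (-s) = 1 := by rw [← Real.exp_add]; simp
    rw [Real.sinh_eq]
    linear_combination e1 / 4 + e2 / 4 - e3 / 2
  have h3 : Real.log u = 2 * s := by rw [hs]; ring
  rw [h3]
  linarith

/-- Apply the previous bound to `√w` and use `4√w ≤ 2w + 2`. Only the powers `1` and `-1/2` remain,
and the right side vanishes at `w = 1`, so no constant-order term survives. -/
theorem sq_log_le_add_inv_sqrt {w : ℝ} (hw : 0 < w) :
    Real.log w ^ 2 ≤ 2 * w + 4 * (√w)⁻¹ - 6 := by
  have hu := Real.sqrt_pos.mpr hw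
  have h1 := sq_log_le_add_inv hu
  rw [Real.log_sqrt hw.le] at h1
  nlinarith [Real.sq_sqrt hw.le, sq_nonneg (√w - 1)]

/-- Log-convexity of Gamma at the midpoint `(n-1)/2` of `n/2 - 1` and `n/2`, followed by the
recursion for Gamma. -/
theorem Gamma_half_sub_div_sq_le {n : ℝ} (hn : 2 < n) :
    n / 2 * (Real.Gamma ((n - 1) / 2) / Real.Gamma (n / 2)) ^ 2 ≤ n / (n - 2) := by
  have hpos := Real.Gamma_pos_of_pos (show 0 < n / 2 by linarith)
  have hpos' := Real.Gamma_pos_of_pos (show 0 < n / 2 - 1 by linarith)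
  have h1 := Real.Gamma_mul_add_mul_le_rpow_Gamma_mul_rpow_Gamma
    (show 0 < n / 2 by linarith) (show 0 < n / 2 - 1 by linarith)
    (show (0 : ℝ) < 1 / 2 by norm_num) (show (0 : ℝ) < 1 / 2 by norm_num) (by norm_num)
  rw [← Real.sqrt_eq_rpow, ← Real.sqrt_eq_rpow,
    show 1 / 2 * (n / 2) + 1 / 2 * (n / 2 - 1) = (n - 1) / 2 by ring] at h1
  have h2 := pow_le_pow_left₀ (Real.Gamma_pos_of_pos (show 0 < (n - 1) / 2 by linarith)).le h1 2
  rw [mul_pow, Real.sq_sqrt hpos.le, Real.sq_sqrt hpos'.le] at h2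
  have h3 : Real.Gamma (n / 2) = (n / 2 - 1) * Real.Gamma (n / 2 - 1) := by
    rw [← Real.Gamma_add_one (by linarith : (n / 2 - 1) ≠ 0)]
    congr 1
    ring
  have h4 : Real.Gamma (n / 2 - 1) = Real.Gamma (n / 2) / (n / 2 - 1) := by
    rw [h3, mul_div_cancel_left₀]
    linarith
  rw [h4] at h2
  rw [div_pow]
  have h5 : Real.Gamma ((n - 1) / 2) ^ 2 / Real.Gamma (n / 2) ^ 2 ≤ 1 / (n / 2 - 1) := by
    rw [div_le_iff₀ (by positivity)]
    calc _ ≤ _ := h2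
      _ = _ := by ring
  calc _ ≤ n / 2 * (1 / (n / 2 - 1)) := mul_le_mul_of_nonneg_left h5 (by linarith)
    _ = n / (n - 2) := by
      have : n - 2 ≠ 0 := by linarith
      have : n / 2 - 1 ≠ 0 := by linarith
      field_simp

/-- The factors `n/(n-2)` for `n = N, …, N-D+1` telescope to the right side. -/
theorem descFactorial_mul_Gamma_ratio_sq_le {N D : ℕ} (h : D + 2 ≤ N) :
    (N.descFactorial D : ℝ) / 2 ^ D *
        (Real.Gamma (((N : ℝ) - D) / 2) / Real.Gamma ((N : ℝ) / 2)) ^ 2 ≤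
      (N : ℝ) * (N - 1) / ((N - D) * (N - D - 1)) := by
  induction D with
  | zero =>
    have hN : (2 : ℝ) ≤ N := by exact_mod_cast h
    have hΓ := Real.Gamma_pos_of_pos (show (0 : ℝ) < (N : ℝ) / 2 by linarith)
    have : (N : ℝ) - 1 ≠ 0 := by linarith
    simp [div_self hΓ.ne']
    rw [div_self (by positivity)]
  | succ D ih =>
    have ih := ih (by omega)
    have hN : (D : ℝ) + 1 + 2 ≤ N := by exact_mod_cast h
    set n : ℝ := (N : ℝ) - D with hn
    have hn2 : 2 < n := by linarith
    have hΓ1 := Real.Gamma_pos_of_pos (show 0 < n / 2 by linarith)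
    have hΓ2 := Real.Gamma_pos_of_pos (show (0 : ℝ) < (N : ℝ) / 2 by linarith [(Nat.cast_nonneg D : (0 : ℝ) ≤ D)])
    have hstep := Gamma_half_sub_div_sq_le hn2
    have hdf : (N.descFactorial (D + 1) : ℝ) = n * N.descFactorial D := by
      rw [Nat.descFactorial_succ, Nat.cast_mul, Nat.cast_sub (by omega)]
    rw [hdf, show (N : ℝ) - ((D + 1 : ℕ) : ℝ) = n - 1 by push_cast; ring]
    calc n * (N.descFactorial D : ℝ) / 2 ^ (D + 1) *
          (Real.Gamma ((n - 1) / 2) / Real.Gamma ((N : ℝ) / 2)) ^ 2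
        = ((N.descFactorial D : ℝ) / 2 ^ D *
            (Real.Gamma (n / 2) / Real.Gamma ((N : ℝ) / 2)) ^ 2) *
          (n / 2 * (Real.Gamma ((n - 1) / 2) / Real.Gamma (n / 2)) ^ 2) := by
          rw [pow_succ]
          field_simp
      _ ≤ ((N : ℝ) * (N - 1) / (n * (n - 1))) * (n / (n - 2)) :=
          mul_le_mul ih hstep (by positivity)
            (div_nonneg (mul_nonneg (by linarith) (by linarith))
              (mul_nonneg (by linarith) (by linarith)))
      _ = _ := by
          have : n - 2 ≠ 0 := by linarith
          have : n - 1 ≠ 0 := by linarith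
          rw [show n - 1 - 1 = n - 2 by ring]
          field_simp

theorem div_sub_mul_sub_le {N D : ℕ} (h : 4 * (D + 1) ≤ N) :
    (N : ℝ) * (N - 1) / ((N - D) * (N - D - 1)) ≤ 1 + 4 * D / N := by
  have hN : 4 * ((D : ℝ) + 1) ≤ N := by exact_mod_cast h
  have hD : (0 : ℝ) ≤ D := by positivity
  have hN0 : (0 : ℝ) < N := by linarith
  have h1 : (0 : ℝ) < N - D := by linarith
  have h2 : (0 : ℝ) < N - D - 1 := by linarith
  rw [div_le_iff₀ (by positivity)]
  have h3 : (1 + 4 * (D : ℝ) / N) * ((N - D) * (N - D - 1)) - (N : ℝ) * (N - 1) =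
      D * (N * (2 * N - 7 * D - 3) + 4 * D ^ 2 + 4 * D) / N := by
    field_simp
    ring
  have h4 : 0 ≤ D * (N * (2 * N - 7 * D - 3) + 4 * (D : ℝ) ^ 2 + 4 * D) / N := by
    have : 0 ≤ 2 * (N : ℝ) - 7 * D - 3 := by linarith
    positivity
  linarith

variable {ι : Type*} [Fintype ι] [DecidableEq ι] {N : ℕ} {μ : Measure (ι → ℝ)}
  [IsProbabilityMeasure μ] {K : Matrix ι ι ℝ}

theorem logDet_scatter_secondMoment (hK : K.PosDef)
    (hμ : ∀ x : ι → ℝ, μ.map (fun v => x ⬝ᵥ v) = gaussianReal 0 (x ⬝ᵥ K.mulVec x).toNNReal)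
    (hint : ∀ a b, Integrable (fun v => v a * v b) μ)
    (hcov : ∀ a b, ∫ v, v a * v b ∂μ = K a b)
    (hN : 4 * (Fintype.card ι + 1) ≤ N) :
    (∀ᵐ z ∂(Measure.pi fun _ : Fin N => μ), 0 < (scatter z).det) ∧
      MemLp (fun z => Real.log ((scatter z).det / (N.descFactorial (Fintype.card ι) * K.det))) 2
        (Measure.pi fun _ : Fin N => μ) ∧
      ∫ z, Real.log ((scatter z).det / (N.descFactorial (Fintype.card ι) * K.det)) ^ 2
        ∂(Measure.pi fun _ : Fin N => μ) ≤ 8 * Fintype.card ι / N := by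
  set D := Fintype.card ι with hD
  set ν := Measure.pi fun _ : Fin N => μ with hν
  have hF : (0 : ℝ) < N.descFactorial D := by
    exact_mod_cast Nat.descFactorial_pos.mpr (by omega)
  have hFK : 0 < (N.descFactorial D : ℝ) * K.det := mul_pos hF hK.det_pos
  have hmeas : Measurable fun z : Fin N → ι → ℝ => (scatter z).det := measurable_det_scatter
  have hmeas' : Measurable fun z : Fin N → ι → ℝ => (√(scatter z).det)⁻¹ := hmeas.sqrt.inv
  have hlog : Measurable fun z : Fin N → ι → ℝ =>
      Real.log ((scatter z).det / (N.descFactorial D * K.det)) :=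
    Real.measurable_log.comp (hmeas.div_const _)
  have hneg := lintegral_det_scatter_rpow_neg_half_le hK hμ (N := N) (by omega)
  rw [← hν, ← hD] at hneg
  set B := (√K.det)⁻¹ * (√2 ^ D)⁻¹ *
    (Real.Gamma (((N : ℝ) - D) / 2) / Real.Gamma ((N : ℝ) / 2)) with hB
  have hND : (D : ℝ) < N := by exact_mod_cast (by omega : D < N)
  have hB0 : 0 ≤ B := by
    have h1 := Real.Gamma_pos_of_pos (show (0 : ℝ) < ((N : ℝ) - D) / 2 by linarith)
    have h2 := Real.Gamma_nonneg_of_nonneg (show (0 : ℝ) ≤ (N : ℝ) / 2 by positivity)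
    positivity
  -- In `ENNReal`, `0 ^ (-1/2) = ∞`, so the finite integral excludes a vanishing determinant.
  have hpos : ∀ᵐ z ∂ν, 0 < (scatter z).det := by
    have h1 := ae_lt_top (μ := ν)
      (f := fun z => ENNReal.ofReal (scatter z).det ^ (-(1 / 2) : ℝ)) (by fun_prop)
      (ne_top_of_le_ne_top ENNReal.ofReal_ne_top hneg)
    filter_upwards [h1] with z hz
    by_contra h
    rw [ENNReal.ofReal_of_nonpos (not_lt.mp h), ENNReal.zero_rpow_of_neg (by norm_num)] at hz
    exact lt_irrefl _ hz
  have hg : ∫⁻ z, ENNReal.ofReal (√(scatter z).det)⁻¹ ∂ν ≤ ENNReal.ofReal B := by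
    refine le_of_eq_of_le (lintegral_congr_ae ?_) hneg
    filter_upwards [hpos] with z hz
    rw [ENNReal.ofReal_rpow_of_pos hz, Real.rpow_neg hz.le, Real.sqrt_eq_rpow]
  have hgint : Integrable (fun z => (√(scatter z).det)⁻¹) ν := by
    refine ⟨hmeas'.aestronglyMeasurable, ?_⟩
    rw [hasFiniteIntegral_iff_ofReal (Filter.Eventually.of_forall fun z => by positivity)]
    exact lt_of_le_of_lt hg ENNReal.ofReal_lt_top
  have hgle : ∫ z, (√(scatter z).det)⁻¹ ∂ν ≤ B := by
    rw [integral_eq_lintegral_of_nonneg_ae (Filter.Eventually.of_forall fun z => by positivity)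
      hmeas'.aestronglyMeasurable]
    exact ENNReal.toReal_le_of_le_ofReal hB0 hg
  obtain ⟨hTint, hTval⟩ := integrable_det_scatter (N := N) hint hcov
  rw [← hν, ← hD] at hTval
  rw [← hν] at hTint
  set c := (N.descFactorial D : ℝ) * K.det with hc
  have hbound : ∀ᵐ z ∂ν, Real.log ((scatter z).det / c) ^ 2 ≤
      2 / c * (scatter z).det + 4 * √c * (√(scatter z).det)⁻¹ - 6 := by
    filter_upwards [hpos] with z hz
    refine (sq_log_le_add_inv_sqrt (div_pos hz hFK)).trans (le_of_eq ?_)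
    rw [Real.sqrt_div hz.le, inv_div]
    ring
  have hsum : Integrable (fun z => 2 / c * (scatter z).det +
      4 * √c * (√(scatter z).det)⁻¹) ν := (hTint.const_mul _).add (hgint.const_mul _)
  have hbint : Integrable (fun z => 2 / c * (scatter z).det +
      4 * √c * (√(scatter z).det)⁻¹ - 6) ν :=
    hsum.sub (integrable_const _)
  have hsqint : Integrable (fun z => Real.log ((scatter z).det / c) ^ 2) ν := by
    refine hbint.mono' (hlog.pow_const 2).aestronglyMeasurable ?_
    filter_upwards [hbound] with z hz
    rwa [Real.norm_of_nonneg (sq_nonneg _)]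
  refine ⟨hpos, (memLp_two_iff_integrable_sq hlog.aestronglyMeasurable).mpr hsqint, ?_⟩
  have h1 : ∫ z, Real.log ((scatter z).det / c) ^ 2 ∂ν ≤ 4 * (√c * B) - 4 := by
    calc _ ≤ ∫ z, (2 / c * (scatter z).det + 4 * √c * (√(scatter z).det)⁻¹ - 6) ∂ν :=
          integral_mono_ae hsqint hbint hbound
      _ = 2 / c * c + 4 * √c * ∫ z, (√(scatter z).det)⁻¹ ∂ν - 6 := by
          rw [integral_sub hsum (integrable_const _),
            integral_add (hTint.const_mul _) (hgint.const_mul _), integral_const_mul,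
            integral_const_mul, hTval]
          simp
      _ ≤ 2 / c * c + 4 * √c * B - 6 := by
          have := mul_le_mul_of_nonneg_left hgle (show 0 ≤ 4 * √c by positivity)
          linarith
      _ = _ := by
          rw [div_mul_cancel₀ _ hFK.ne']
          ring
  have h2 : (√c * B) ^ 2 = (N.descFactorial D : ℝ) / 2 ^ D *
      (Real.Gamma (((N : ℝ) - D) / 2) / Real.Gamma ((N : ℝ) / 2)) ^ 2 := by
    have hk := hK.det_pos
    rw [hB, mul_pow, mul_pow, mul_pow, Real.sq_sqrt hFK.le, inv_pow, Real.sq_sqrt hk.le, inv_pow,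
      ← pow_mul, mul_comm D 2, pow_mul, Real.sq_sqrt zero_le_two, hc]
    field_simp
  have h3 := (descFactorial_mul_Gamma_ratio_sq_le (N := N) (D := D) (by omega)).trans
    (div_sub_mul_sub_le hN)
  rw [← h2] at h3
  have h4 : (8 : ℝ) * D / N = 2 * (4 * D / N) := by ring
  rw [h4]
  -- With `t = √c * B`: `4(t - 1) ≤ 2(t² - 1) ≤ 8D/N`.
  nlinarith [sq_nonneg (√c * B - 1)]

end LogDetSecondMoment

/-! ### Transfer to i.i.d. random vectors and combination of four errors -/

section RandomVectors

variable {Ω : Type*} [MeasurableSpace Ω] {P : Measure Ω} [IsProbabilityMeasure P]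
  {ι : Type*} [Fintype ι]

theorem dotProduct_covariance_mulVec {V : Ω → ι → ℝ} (hV : ∀ a, MemLp (fun ω => V ω a) 2 P)
    (x : ι → ℝ) :
    x ⬝ᵥ (Matrix.of fun a b => covariance (fun ω => V ω a) (fun ω => V ω b) P).mulVec x =
      variance (fun ω => x ⬝ᵥ V ω) P := by
  have hm : ∀ a, MemLp (fun ω => x a * V ω a) 2 P := fun a => (hV a).const_mul (x a)
  have hmeas : AEMeasurable (fun ω => ∑ a, x a * V ω a) P :=
    (memLp_finsetSum Finset.univ fun a _ => hm a).aestronglyMeasurable.aemeasurable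
  simp only [dotProduct, Matrix.mulVec, Matrix.of_apply]
  rw [← covariance_self hmeas, covariance_fun_sum_fun_sum hm hm]
  refine Finset.sum_congr rfl fun a _ => ?_
  rw [Finset.mul_sum]
  refine Finset.sum_congr rfl fun b _ => ?_
  rw [covariance_const_mul_left, covariance_const_mul_right]
  ring

theorem posSemidef_covariance {V : Ω → ι → ℝ} (hV : ∀ a, MemLp (fun ω => V ω a) 2 P) :
    (Matrix.of fun a b => covariance (fun ω => V ω a) (fun ω => V ω b) P).PosSemidef := by
  refine Matrix.PosSemidef.of_dotProduct_mulVec_nonneg ?_ fun x => ?_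
  · ext a b
    simp [covariance_comm]
  · rw [star_trivial, dotProduct_covariance_mulVec hV]
    exact variance_nonneg _ _

theorem logDet_scatter_secondMoment_of_iid [DecidableEq ι] {V : ℕ → Ω → ι → ℝ}
    (hind : iIndepFun V P)
    (hid : ∀ l, IdentDistrib (V l) (V 0) P P) (hgauss : HasGaussianLaw (V 0) P)
    (hmean : ∀ a, ∫ ω, V 0 ω a ∂P = 0) {K : Matrix ι ι ℝ}
    (hKcov : K = Matrix.of fun a b => covariance (fun ω => V 0 ω a) (fun ω => V 0 ω b) P)
    (hK : K.PosDef) {N : ℕ} (hN : 4 * (Fintype.card ι + 1) ≤ N) :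
    (∀ᵐ ω ∂P, 0 < (scatter fun l : Fin N => V l ω).det) ∧
      MemLp (fun ω => Real.log ((scatter fun l : Fin N => V l ω).det /
        (N.descFactorial (Fintype.card ι) * K.det))) 2 P ∧
      ∫ ω, Real.log ((scatter fun l : Fin N => V l ω).det /
        (N.descFactorial (Fintype.card ι) * K.det)) ^ 2 ∂P ≤ 8 * Fintype.card ι / N := by
  have hV0 := hgauss.aemeasurable
  set μ := P.map (V 0) with hμdef
  have : IsProbabilityMeasure μ := Measure.isProbabilityMeasure_map hV0
  have hmem : ∀ a, MemLp (fun ω => V 0 ω a) 2 P := fun a =>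
    (hgauss.map_fun (ContinuousLinearMap.proj a)).memLp_two
  have hdot : ∀ x : ι → ℝ, Measurable fun v : ι → ℝ => x ⬝ᵥ v := fun x => by
    simp only [dotProduct]
    fun_prop
  have hμ : ∀ x : ι → ℝ, μ.map (fun v => x ⬝ᵥ v) =
      gaussianReal 0 (x ⬝ᵥ K.mulVec x).toNNReal := by
    intro x
    have hg : HasGaussianLaw (fun ω => x ⬝ᵥ V 0 ω) P := by
      have h := hgauss.map_fun
        (LinearMap.toContinuousLinearMap (dotProductBilin ℝ ℝ x : (ι → ℝ) →ₗ[ℝ] ℝ))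
      exact h
    have hm0 : ∫ ω, x ⬝ᵥ V 0 ω ∂P = 0 := by
      simp only [dotProduct]
      rw [integral_finsetSum _ fun a _ => ((hmem a).integrable one_le_two).const_mul _]
      simp [integral_const_mul, hmean]
    rw [hμdef, AEMeasurable.map_map_of_aemeasurable (hdot x).aemeasurable hV0]
    have h := hg.map_eq_gaussianReal
    rw [hm0, ← dotProduct_covariance_mulVec hmem x, ← hKcov] at h
    exact h
  have hint : ∀ a b, Integrable (fun v : ι → ℝ => v a * v b) μ := by
    intro a b
    rw [hμdef, integrable_map_measure (by fun_prop) hV0]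
    exact (hmem a).integrable_mul (hmem b)
  have hcov : ∀ a b, ∫ v, v a * v b ∂μ = K a b := by
    intro a b
    rw [hμdef, integral_map hV0 (by fun_prop), hKcov, Matrix.of_apply,
      covariance_eq_sub (hmem a) (hmem b), hmean a]
    simp
  have hVm : ∀ l, AEMeasurable (V l) P := fun l => (hid l).aemeasurable_fst
  have hmap : P.map (fun ω (l : Fin N) => V l ω) = Measure.pi fun _ : Fin N => μ := by
    rw [(hind.precomp Fin.val_injective).map_fun_eq_pi_map fun l : Fin N => hVm l]
    congr 1
    ext1 l
    exact (hid l).map_eq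
  have hW : AEMeasurable (fun ω (l : Fin N) => V l ω) P :=
    aemeasurable_pi_lambda _ fun l => hVm l
  obtain ⟨h1, h2, h3⟩ := logDet_scatter_secondMoment hK hμ hint hcov hN
  rw [← hmap] at h1 h2 h3
  refine ⟨ae_of_ae_map hW h1, ?_, ?_⟩
  · exact (memLp_map_measure_iff h2.aestronglyMeasurable hW).mp h2
  · exact (integral_map hW (h2.aestronglyMeasurable.pow 2)).symm.trans_le h3

theorem abs_integral_le_sqrt {L : Ω → ℝ} (hL : MemLp L 2 P) {ε : ℝ} (h : ∫ ω, L ω ^ 2 ∂P ≤ ε) :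
    |∫ ω, L ω ∂P| ≤ √ε := by
  refine Real.abs_le_sqrt (le_trans ?_ h)
  have h1 := variance_nonneg L P
  rw [variance_eq_sub hL] at h1
  simpa using h1

/-- By Cauchy–Schwarz the square of half a signed sum of four terms is at most the sum of their
squares, so no independence between the four errors is needed. -/
theorem half_signed_sum_estimates {E L₁ L₂ L₃ L₄ : Ω → ℝ} {c ε₁ ε₂ ε₃ ε₄ : ℝ}
    (h₁ : MemLp L₁ 2 P) (h₂ : MemLp L₂ 2 P) (h₃ : MemLp L₃ 2 P) (h₄ : MemLp L₄ 2 P)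
    (b₁ : ∫ ω, L₁ ω ^ 2 ∂P ≤ ε₁) (b₂ : ∫ ω, L₂ ω ^ 2 ∂P ≤ ε₂)
    (b₃ : ∫ ω, L₃ ω ^ 2 ∂P ≤ ε₃) (b₄ : ∫ ω, L₄ ω ^ 2 ∂P ≤ ε₄)
    (hE : ∀ᵐ ω ∂P, E ω = c + (1 / 2) * (L₁ ω + L₂ ω - (L₃ ω + L₄ ω))) :
    MemLp E 2 P ∧ variance E P ≤ ε₁ + ε₂ + ε₃ + ε₄ ∧
      |∫ ω, E ω ∂P - c| ≤ √(ε₁ + ε₂ + ε₃ + ε₄) := by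
  set S : Ω → ℝ := fun ω => (1 / 2) * (L₁ ω + L₂ ω - (L₃ ω + L₄ ω)) with hS
  have hSm : MemLp S 2 P := ((h₁.add h₂).sub (h₃.add h₄)).const_mul (1 / 2)
  have hEm : MemLp E 2 P := ((memLp_const c).add hSm).ae_eq (hE.mono fun ω h => h.symm)
  have i₁ := h₁.integrable_sq
  have i₂ := h₂.integrable_sq
  have i₃ := h₃.integrable_sq
  have i₄ := h₄.integrable_sq
  have i₁₂ : Integrable (fun ω => L₁ ω ^ 2 + L₂ ω ^ 2) P := i₁.add i₂
  have i₁₂₃ : Integrable (fun ω => L₁ ω ^ 2 + L₂ ω ^ 2 + L₃ ω ^ 2) P := i₁₂.add i₃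
  have hSsq : ∫ ω, S ω ^ 2 ∂P ≤ ε₁ + ε₂ + ε₃ + ε₄ := by
    calc ∫ ω, S ω ^ 2 ∂P ≤ ∫ ω, (L₁ ω ^ 2 + L₂ ω ^ 2 + L₃ ω ^ 2 + L₄ ω ^ 2) ∂P := by
          refine integral_mono hSm.integrable_sq (i₁₂₃.add i₄) fun ω => ?_
          simp only [hS]
          nlinarith [sq_nonneg (L₁ ω - L₂ ω), sq_nonneg (L₁ ω + L₃ ω), sq_nonneg (L₁ ω + L₄ ω),
            sq_nonneg (L₂ ω + L₃ ω), sq_nonneg (L₂ ω + L₄ ω), sq_nonneg (L₃ ω - L₄ ω)]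
      _ = ∫ ω, L₁ ω ^ 2 ∂P + ∫ ω, L₂ ω ^ 2 ∂P + ∫ ω, L₃ ω ^ 2 ∂P + ∫ ω, L₄ ω ^ 2 ∂P := by
          rw [integral_add i₁₂₃ i₄, integral_add i₁₂ i₃, integral_add i₁ i₂]
      _ ≤ _ := by linarith
  refine ⟨hEm, ?_, ?_⟩
  · rw [variance_congr hE, variance_const_add hSm.aestronglyMeasurable]
    exact (variance_le_expectation_sq hSm.aestronglyMeasurable).trans hSsq
  · rw [integral_congr_ae hE, integral_add (integrable_const c) (hSm.integrable one_le_two)]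
    simpa using abs_integral_le_sqrt hSm hSsq

end RandomVectors

/-! ### Prefixes and their sample covariance determinants -/

section Prefixes

variable {m dx dy : ℕ}

/-- The prefix `(x^i, y^j)` as a linear function of the pair of sequences. -/
def prefixLinearMap (m dx dy i j : ℕ) : SeqPair m dx dy →ₗ[ℝ] (PrefixIdx m dx dy i j → ℝ) where
  toFun z := prefixVec z i j
  map_add' z w := by
    ext (⟨t, a⟩ | ⟨t, b⟩) <;> simp [prefixVec]
  map_smul' c z := by
    ext (⟨t, a⟩ | ⟨t, b⟩) <;> simp [prefixVec]

theorem card_prefixIdx_le (m dx dy i j : ℕ) :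
    Fintype.card (PrefixIdx m dx dy i j) ≤ 2 * (max dx dy * m) := by
  have h : ∀ k : ℕ, Fintype.card {t : Fin m // (t : ℕ) < k} ≤ m := fun k =>
    (Fintype.card_subtype_le _).trans (Fintype.card_fin m).le
  rw [Fintype.card_sum, Fintype.card_prod, Fintype.card_prod, Fintype.card_fin, Fintype.card_fin]
  calc _ ≤ m * max dx dy + m * max dx dy := by
        gcongr
        exacts [h i, le_max_left _ _, h j, le_max_right _ _]
    _ = _ := by ring

/-- A shorter prefix has a principal submatrix as its covariance, so nonsingularity of the largest
matrix is enough for all four. -/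
theorem covMatrix_posDef_of_le {Ω : Type*} [MeasurableSpace Ω] {P : Measure Ω}
    {Z : Ω → SeqPair m dx dy} {i j i' j' : ℕ} (hi : i' ≤ i) (hj : j' ≤ j)
    (h : (covMatrix P Z i j).PosDef) : (covMatrix P Z i' j').PosDef := by
  have he : Function.Injective (Sum.map
      (Prod.map (Subtype.map id fun _ ht => lt_of_lt_of_le ht hi) id)
      (Prod.map (Subtype.map id fun _ ht => lt_of_lt_of_le ht hj) id) :
        PrefixIdx m dx dy i' j' → PrefixIdx m dx dy i j) :=
    Sum.map_injective.mpr
      ⟨(Subtype.map_injective _ Function.injective_id).prodMap Function.injective_id,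
        (Subtype.map_injective _ Function.injective_id).prodMap Function.injective_id⟩
  have heq : covMatrix P Z i' j' = (covMatrix P Z i j).submatrix (Sum.map
      (Prod.map (Subtype.map id fun _ ht => lt_of_lt_of_le ht hi) id)
      (Prod.map (Subtype.map id fun _ ht => lt_of_lt_of_le ht hj) id))
      (Sum.map
      (Prod.map (Subtype.map id fun _ ht => lt_of_lt_of_le ht hi) id)
      (Prod.map (Subtype.map id fun _ ht => lt_of_lt_of_le ht hj) id)) := by
    ext (⟨t, a⟩ | ⟨t, a⟩) (⟨s, b⟩ | ⟨s, b⟩) <;> rfl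
  rw [heq]
  exact h.submatrix he

theorem det_sampleCovMatrix {N : ℕ} (z : Fin N → SeqPair m dx dy) (i j : ℕ) :
    (sampleCovMatrix z i j).det = (scatter fun l => prefixVec (z l) i j).det /
      (N : ℝ) ^ Fintype.card (PrefixIdx m dx dy i j) := by
  rw [sampleCovMatrix, Matrix.det_smul, inv_pow, inv_mul_eq_div]
  rfl

/-- The logarithm of `N (N - 1) ⋯ (N - D + 1) / N ^ D`, which centers the log-determinant of a
sample covariance matrix of size `D`. -/
noncomputable def logDetShift (N D : ℕ) : ℝ := Real.log (N.descFactorial D / (N : ℝ) ^ D)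

theorem tendsto_logDetShift (D : ℕ) :
    Filter.Tendsto (fun N => logDetShift N D) Filter.atTop (nhds 0) := by
  have h : Filter.Tendsto (fun N : ℕ => (N.descFactorial D : ℝ) / (N : ℝ) ^ D) Filter.atTop
      (nhds 1) := by
    refine (Asymptotics.isEquivalent_iff_tendsto_one ?_).mp (isEquivalent_descFactorial D)
    filter_upwards [Filter.eventually_gt_atTop 0] with N hN
    positivity
  simpa [logDetShift] using h.log one_ne_zero

section Estimates

variable {Ω : Type*} [MeasurableSpace Ω] {P : Measure Ω}

theorem integral_prefixVec_eq_zero {W : Ω → SeqPair m dx dy}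
    (hx : ∀ t a, ∫ ω, (W ω).1 t a ∂P = 0) (hy : ∀ t b, ∫ ω, (W ω).2 t b ∂P = 0) (i j : ℕ)
    (a : PrefixIdx m dx dy i j) : ∫ ω, prefixVec (W ω) i j a ∂P = 0 := by
  rcases a with ⟨t, a⟩ | ⟨t, b⟩
  exacts [hx t.1 a, hy t.1 b]

theorem hasGaussianLaw_prefixVec {W : Ω → SeqPair m dx dy} (h : HasGaussianLaw W P) (i j : ℕ) :
    HasGaussianLaw (fun ω => prefixVec (W ω) i j) P :=
  h.map_fun (LinearMap.toContinuousLinearMap (prefixLinearMap m dx dy i j))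

theorem measurable_prefixVec (i j : ℕ) :
    Measurable fun z : SeqPair m dx dy => prefixVec z i j :=
  (LinearMap.continuous_of_finiteDimensional (prefixLinearMap m dx dy i j)).measurable

theorem covMatrix_posSemidef [IsProbabilityMeasure P] {W : Ω → SeqPair m dx dy} (h : HasGaussianLaw W P) (i j : ℕ) :
    (covMatrix P W i j).PosSemidef :=
  posSemidef_covariance (V := fun ω => prefixVec (W ω) i j) fun a =>
    ((hasGaussianLaw_prefixVec h i j).map_fun (ContinuousLinearMap.proj a)).memLp_two

theorem logDet_sampleCovMatrix_estimates [IsProbabilityMeasure P]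
    {Z : ℕ → Ω → SeqPair m dx dy} (hind : iIndepFun Z P)
    (hid : ∀ l, IdentDistrib (Z l) (Z 0) P P) (hgauss : HasGaussianLaw (Z 0) P)
    (hx : ∀ t a, ∫ ω, (Z 0 ω).1 t a ∂P = 0) (hy : ∀ t b, ∫ ω, (Z 0 ω).2 t b ∂P = 0)
    {i j : ℕ} (hK : (covMatrix P (Z 0) i j).PosDef) {N : ℕ}
    (hN : 4 * (2 * (max dx dy * m) + 1) ≤ N) :
    ∃ L : Ω → ℝ, MemLp L 2 P ∧
      ∫ ω, L ω ^ 2 ∂P ≤ 16 * (((max dx dy : ℕ) : ℝ) * (m : ℝ) / (N : ℝ)) ∧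
      ∀ᵐ ω ∂P, 0 < (sampleCovMatrix (fun l : Fin N => Z l ω) i j).det ∧
        Real.log (sampleCovMatrix (fun l : Fin N => Z l ω) i j).det =
          Real.log (covMatrix P (Z 0) i j).det +
            logDetShift N (Fintype.card (PrefixIdx m dx dy i j)) + L ω := by
  set D := Fintype.card (PrefixIdx m dx dy i j) with hD
  have hDle : D ≤ 2 * (max dx dy * m) := card_prefixIdx_le m dx dy i j
  have hpm := measurable_prefixVec (m := m) (dx := dx) (dy := dy) i j
  obtain ⟨h1, h2, h3⟩ := logDet_scatter_secondMoment_of_iid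
    (V := fun l ω => prefixVec (Z l ω) i j) (K := covMatrix P (Z 0) i j) (N := N)
    (hind.comp (fun _ z => prefixVec z i j) fun _ => hpm) (fun l => (hid l).comp hpm)
    (hasGaussianLaw_prefixVec hgauss i j) (integral_prefixVec_eq_zero hx hy i j) rfl hK
    (by omega)
  refine ⟨_, h2, h3.trans ?_, ?_⟩
  · have : (D : ℝ) ≤ 2 * (((max dx dy : ℕ) : ℝ) * m) := by exact_mod_cast hDle
    calc (8 : ℝ) * D / N ≤ 8 * (2 * (((max dx dy : ℕ) : ℝ) * m)) / N := by gcongr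
      _ = _ := by ring
  · filter_upwards [h1] with ω hω
    have hN0 : (0 : ℝ) < N := by exact_mod_cast (by omega : 0 < N)
    have hF : (0 : ℝ) < N.descFactorial D := by
      exact_mod_cast Nat.descFactorial_pos.mpr (by omega)
    have hk := hK.det_pos
    rw [det_sampleCovMatrix]
    refine ⟨by positivity, ?_⟩
    rw [logDetShift, Real.log_div hω.ne' (by positivity), Real.log_div hF.ne' (by positivity),
      Real.log_div hω.ne' (by positivity), Real.log_mul hF.ne' hk.ne']
    ring

end Estimates

end Prefixes

end InfoMat

/-! ### Bias and variance of the estimator -/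

theorem proposition4 :
    ∃ C : ℝ, 0 < C ∧ ∀ m dx dy : ℕ, ∃ N₀ : ℕ,
      ∀ (Ω : Type*) [MeasurableSpace Ω] (P : Measure Ω) [IsProbabilityMeasure P]
        (X : ℕ → Ω → Fin m → EuclideanSpace ℝ (Fin dx))
        (Y : ℕ → Ω → Fin m → EuclideanSpace ℝ (Fin dy)),
        -- the pairs of sequences `(X l, Y l)` are i.i.d. ...
        iIndepFun (fun l ω => (X l ω, Y l ω)) P →
        (∀ l, IdentDistrib (fun ω => (X l ω, Y l ω)) (fun ω => (X 0 ω, Y 0 ω)) P P) →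
        -- ... jointly Gaussian with mean zero
        HasGaussianLaw (fun ω => (X 0 ω, Y 0 ω)) P →
        (∀ t a, ∫ ω, X 0 ω t a ∂P = 0) →
        (∀ t b, ∫ ω, Y 0 ω t b ∂P = 0) →
        ∀ i j : Fin m,
          -- the covariance matrix of the longest prefix in the entry is nonsingular
          (InfoMat.covMatrix P (fun ω => (X 0 ω, Y 0 ω)) (i + 1) (j + 1)).det ≠ 0 →
          -- the estimator is asymptotically unbiased
          Filter.Tendsto
            (fun N : ℕ => ∫ ω, InfoMat.gaussianInfoMatEstimator
              (fun l : Fin N => (X l ω, Y l ω)) i j ∂P)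
            Filter.atTop
            (nhds (InfoMat.gaussianInfoMat P (fun ω => (X 0 ω, Y 0 ω)) i j)) ∧
          -- its moments up to order two are finite and its variance is `O(d m / N)`
          ∀ N : ℕ, N₀ ≤ N →
            MemLp (fun ω => InfoMat.gaussianInfoMatEstimator
              (fun l : Fin N => (X l ω, Y l ω)) i j) 2 P ∧
            variance (fun ω => InfoMat.gaussianInfoMatEstimator
              (fun l : Fin N => (X l ω, Y l ω)) i j) P
                ≤ C * (((max dx dy : ℕ) : ℝ) * (m : ℝ) / (N : ℝ)) ∧
            -- hence `O(d m² / n)` if the `N` sequences come from data of length `n` with `n / m ≤ N`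
            ∀ n : ℕ, 0 < n → (n : ℝ) / (m : ℝ) ≤ (N : ℝ) →
              variance (fun ω => InfoMat.gaussianInfoMatEstimator
                (fun l : Fin N => (X l ω, Y l ω)) i j) P
                  ≤ C * (((max dx dy : ℕ) : ℝ) * (m : ℝ) ^ 2 / (n : ℝ)) := by
  -- `64 = 4 · 16`: four errors of second moment at most `8D/N ≤ 16dm/N`. The threshold is `4(D + 1)
  -- ≤ N` with `D` replaced by its bound `2dm`.
  refine ⟨64, by norm_num, fun m dx dy => ⟨4 * (2 * (max dx dy * m) + 1), ?_⟩⟩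
  intro Ω _ P _ X Y hind hid hgauss hx hy i j hdet
  set Z : ℕ → Ω → InfoMat.SeqPair m dx dy := fun l ω => (X l ω, Y l ω) with hZ
  have hK₄ : (InfoMat.covMatrix P (Z 0) (i + 1) (j + 1)).PosDef :=
    (InfoMat.covMatrix_posSemidef hgauss _ _).posDef_iff_det_ne_zero.mpr hdet
  have hK₁ : (InfoMat.covMatrix P (Z 0) (i + 1) j).PosDef :=
    InfoMat.covMatrix_posDef_of_le le_rfl (Nat.le_succ _) hK₄
  have hK₂ : (InfoMat.covMatrix P (Z 0) i (j + 1)).PosDef :=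
    InfoMat.covMatrix_posDef_of_le (Nat.le_succ _) le_rfl hK₄
  have hK₃ : (InfoMat.covMatrix P (Z 0) i j).PosDef :=
    InfoMat.covMatrix_posDef_of_le (Nat.le_succ _) (Nat.le_succ _) hK₄
  set I := InfoMat.gaussianInfoMat P (Z 0) i j with hI
  -- The deterministic part of the bias: the four centering shifts combined.
  set s : ℕ → ℝ := fun N => (1 / 2) *
    (InfoMat.logDetShift N (Fintype.card (InfoMat.PrefixIdx m dx dy (i + 1) j)) +
      InfoMat.logDetShift N (Fintype.card (InfoMat.PrefixIdx m dx dy i (j + 1))) -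
      (InfoMat.logDetShift N (Fintype.card (InfoMat.PrefixIdx m dx dy i j)) +
        InfoMat.logDetShift N (Fintype.card (InfoMat.PrefixIdx m dx dy (i + 1) (j + 1))))) with hs
  have hs0 : Filter.Tendsto s Filter.atTop (nhds 0) := by
    have h := fun D₁ D₂ D₃ D₄ : ℕ =>
      (((InfoMat.tendsto_logDetShift D₁).add (InfoMat.tendsto_logDetShift D₂)).sub
        ((InfoMat.tendsto_logDetShift D₃).add (InfoMat.tendsto_logDetShift D₄))).const_mul
          (1 / 2 : ℝ)
    simp only [add_zero, sub_zero, mul_zero] at h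
    exact h _ _ _ _
  have hlog : ∀ {a b c d : ℝ}, 0 < a → 0 < b → 0 < c → 0 < d →
      Real.log ((a * b) / (c * d)) =
        Real.log a + Real.log b - (Real.log c + Real.log d) := by
    intro a b c d ha hb hc hd
    rw [Real.log_div (by positivity) (by positivity), Real.log_mul ha.ne' hb.ne',
      Real.log_mul hc.ne' hd.ne']
  have hmain : ∀ N : ℕ, 4 * (2 * (max dx dy * m) + 1) ≤ N →
      MemLp (fun ω => InfoMat.gaussianInfoMatEstimator (fun l : Fin N => Z l ω) i j) 2 P ∧
      variance (fun ω => InfoMat.gaussianInfoMatEstimator (fun l : Fin N => Z l ω) i j) P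
        ≤ 64 * (((max dx dy : ℕ) : ℝ) * (m : ℝ) / (N : ℝ)) ∧
      |∫ ω, InfoMat.gaussianInfoMatEstimator (fun l : Fin N => Z l ω) i j ∂P - (I + s N)|
        ≤ √(64 * (((max dx dy : ℕ) : ℝ) * (m : ℝ) / (N : ℝ))) := by
    intro N hN
    obtain ⟨L₁, m₁, b₁, e₁⟩ :=
      InfoMat.logDet_sampleCovMatrix_estimates hind hid hgauss hx hy hK₁ hN
    obtain ⟨L₂, m₂, b₂, e₂⟩ :=
      InfoMat.logDet_sampleCovMatrix_estimates hind hid hgauss hx hy hK₂ hN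
    obtain ⟨L₃, m₃, b₃, e₃⟩ :=
      InfoMat.logDet_sampleCovMatrix_estimates hind hid hgauss hx hy hK₃ hN
    obtain ⟨L₄, m₄, b₄, e₄⟩ :=
      InfoMat.logDet_sampleCovMatrix_estimates hind hid hgauss hx hy hK₄ hN
    have h := InfoMat.half_signed_sum_estimates
      (E := fun ω => InfoMat.gaussianInfoMatEstimator (fun l : Fin N => Z l ω) i j)
      (c := I + s N) m₁ m₂ m₃ m₄ b₁ b₂ b₃ b₄ (by
        filter_upwards [e₁, e₂, e₃, e₄] with ω h₁ h₂ h₃ h₄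
        simp only [hI, hs, InfoMat.gaussianInfoMatEstimator, InfoMat.gaussianInfoMat,
          InfoMat.logDetMatrix, Matrix.of_apply]
        rw [hlog h₁.1 h₂.1 h₃.1 h₄.1, hlog hK₁.det_pos hK₂.det_pos hK₃.det_pos hK₄.det_pos,
          h₁.2, h₂.2, h₃.2, h₄.2]
        ring)
    have h64 : ∀ t : ℝ, 16 * t + 16 * t + 16 * t + 16 * t = 64 * t := fun t => by ring
    rwa [h64] at h
  refine ⟨?_, fun N hN => ⟨(hmain N hN).1, (hmain N hN).2.1, fun n hn hnN => ?_⟩⟩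
  · have hε : Filter.Tendsto
        (fun N : ℕ => √(64 * (((max dx dy : ℕ) : ℝ) * (m : ℝ) / (N : ℝ))))
        Filter.atTop (nhds 0) := by
      have h := ((tendsto_const_div_atTop_nhds_zero_nat
        (((max dx dy : ℕ) : ℝ) * (m : ℝ))).const_mul (64 : ℝ)).sqrt
      simpa using h
    have hdiff : Filter.Tendsto (fun N : ℕ => ∫ ω, InfoMat.gaussianInfoMatEstimator
        (fun l : Fin N => Z l ω) i j ∂P - (I + s N)) Filter.atTop (nhds 0) := by
      refine squeeze_zero_norm' ?_ hε
      filter_upwards [Filter.eventually_ge_atTop (4 * (2 * (max dx dy * m) + 1))] with N hN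
      exact (hmain N hN).2.2
    have h := hdiff.add (hs0.const_add I)
    simpa using h
  · have hm : (0 : ℝ) < m := by exact_mod_cast i.pos
    have hn' : (0 : ℝ) < n := by exact_mod_cast hn
    have hN' : (0 : ℝ) < N := lt_of_lt_of_le (by positivity) hnN
    refine (hmain N hN).2.1.trans (mul_le_mul_of_nonneg_left ?_ (by norm_num))
    calc ((max dx dy : ℕ) : ℝ) * (m : ℝ) / (N : ℝ)
        ≤ ((max dx dy : ℕ) : ℝ) * (m : ℝ) / ((n : ℝ) / m) := by gcongr
      _ = _ := by
          field_simp
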